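/- Let $K\ge 2$ and $a,b\ge 0$ be integers with $a+b\ge 1$. Consider the $(K,a,b)$ coded caching problem for location-based content. There are $K$ cache nodes on a ring and $K$ users, user $k$ being connected to cache node $k$ ($k=1,\dots,K$, indices modulo $K$). The library has $N=K(a+b)$ files of $B$ bits each: for every $k$ there is a set $\mathcal S_k$ of $a$ files and a set $\mathcal U_k$ of $b$ files, all these $2K$ sets being pairwise disjoint. User $k$ may request any one file $W_{d_k}$ of its demand set $\mathcal D_k=\mathcal S_k\cup\mathcal U_k\cup\mathcal S_{k+1}$ (the files shared with the left-hand neighbour, its own files, and the files shared with the right-hand neighbour). Before the demands are known, each cache node stores at most $MB$ bits; the placement is uncoded if every stored bit is a copy of a fixed bit of the library. Once the demand vector $(d_1,\dots,d_K)\in\mathcal D_1\times\dots\times\mathcal D_K$ is known to everyone, the server broadcasts a message of at most $RB$ bits (a function of the demand vector and the library), from which, together with the content of its cache node and the demand vector, every user $k$ must recover $W_{d_k}$, for every demand vector and every content of the library. Let $R^\star_{\mathrm u}=R^\star_{\mathrm u}(M)$ be the minimum worst-case load under uncoded cache placement, that is, the infimum of all $R$ that are achievable in this way with uncoded placement for some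 file size $B\geq 1$; equivalently, the limit as $B\to\infty$ of the smallest load achievable with file size $B$ (that the two agree is part of the claim). If $b(K-1)<2a$, then $$R^\star_{\mathrm u}=\begin{cases} K-\dfrac{K+1}{2(a+b)}\,M, & 0\le M\le a+b,\\[2mm] \dfrac{(K-1)(2a+b)}{2a}-\dfrac{K-1}{2a}\,M, & a+b<M\le 2a+b.\end{cases}$$ If $b(K-1)\ge 2a$, then for $0\le M\le 2a+b$ $$R^\star_{\mathrm u}=K-\frac{K}{2a+b}\,M .$$ -/

import Mathlib

namespace LocationCaching

/-- The library of the `(K, a, b)` problem: `N = K (a + b)` files. Nodes and regions are numbered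
`0, …, K - 1` around a ring. The file `(k, Sum.inl j)` is the `j`-th of the `a` files shared by
region `k` and its left-hand neighbour `k - 1`; the file `(k, Sum.inr j)` is the `j`-th of the `b`
files that only region `k` is interested in. Listing the files region by region, shared ones first,
gives them the numbers `k (a + b) + j` and `k (a + b) + a + j`. -/
abbrev FileIdx (K a b : ℕ) : Type := Fin K × (Fin a ⊕ Fin b)

/-- The right-hand neighbour of region `k` on the ring of `K` regions. -/
def next {K : ℕ} (k : Fin K) : Fin K := ⟨(k.val + 1) % K, Nat.mod_lt _ k.pos⟩

/-- The demand set of region `k`: the `a` files shared with the left-hand neighbour, the `b` files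
of its own, and the `a` files shared with the right-hand neighbour. -/
def demandSet (K a b : ℕ) (k : Fin K) : Set (FileIdx K a b) :=
  (Set.range fun j : Fin a => ((k, Sum.inl j) : FileIdx K a b)) ∪
    (Set.range fun j : Fin b => ((k, Sum.inr j) : FileIdx K a b)) ∪
    (Set.range fun j : Fin a => ((next k, Sum.inl j) : FileIdx K a b))

/-- A content of the whole library, every file consisting of `B` bits. -/
abbrev Library (K a b B : ℕ) : Type := FileIdx K a b → Fin B → Bool

/-- Demand vectors: user `k` requests one file of the demand set of region `k`. -/
abbrev Demand (K a b : ℕ) : Type := (k : Fin K) → demandSet K a b k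

/-- A caching scheme with files of `B` bits, caches of `m` bits and a broadcast message of `L` bits:
placement functions (which do not see the demand), an encoding function and decoding functions such
that, for every demand vector and every content of the library, every user recovers the requested
file from its own cache node and the broadcast message. -/
structure Scheme (K a b B m L : ℕ) where
  /-- the content of the cache node `k` -/
  place : Fin K → Library K a b B → (Fin m → Bool)
  /-- the broadcast message -/
  encode : Demand K a b → Library K a b B → (Fin L → Bool)
  /-- the decoder of user `k` -/
  decode : Fin K → Demand K a b → (Fin m → Bool) → (Fin L → Bool) → (Fin B → Bool)
  /-- correct decoding, for all demands and all library contents -/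
  decode_eq : ∀ (d : Demand K a b) (W : Library K a b B) (k : Fin K),
    decode k d (place k W) (encode d W) = W (d k)

/-- The cache placement is uncoded: each cached bit is a copy of one bit of the library, whose
position does not depend on the content of the library. -/
def Scheme.IsUncoded {K a b B m L : ℕ} (s : Scheme K a b B m L) : Prop :=
  ∀ k : Fin K, ∃ pos : Fin m → FileIdx K a b × Fin B,
    ∀ (W : Library K a b B) (i : Fin m), s.place k W i = W (pos i).1 (pos i).2

/-- With files of `B` bits, some scheme with uncoded placement uses at most `M B` bits of cache per
node and broadcasts at most `R B` bits, whatever the demands are. -/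
def UncodedAchievable (K a b B : ℕ) (M R : ℝ) : Prop :=
  ∃ m L : ℕ, (m : ℝ) ≤ M * B ∧ (L : ℝ) ≤ R * B ∧ ∃ s : Scheme K a b B m L, s.IsUncoded

/-- `r` is the minimum worst-case load under uncoded cache placement for the cache size `M`: it is
the infimum of the loads that are achievable with some file size, and every load above `r` is
achievable with all sufficiently large file sizes. In particular `r` is also the limit, as the file
size grows, of the smallest load achievable with that file size. -/
def IsOptimalUncodedLoad (K a b : ℕ) (M r : ℝ) : Prop :=
  IsGLB {R : ℝ | ∃ B : ℕ, 0 < B ∧ UncodedAchievable K a b B M R} r ∧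
    ∀ ε : ℝ, 0 < ε → ∀ᶠ B : ℕ in Filter.atTop, UncodedAchievable K a b B M (r + ε)

end LocationCaching

/-!
**Lower bounds.** For a fixed demand vector with distinct requests and an order of the users, the
message must carry, for each user, the bits of its request that are missing from its own cache and
from those of all users before it (`card_le_of_acyclic`, `sum_uncached_le`). Four families of
demands suffice:

* everybody requests a file shared with the left-hand neighbour, decoding in descending order around
  the ring, or the mirror image of this (`shared_bound_all_users`);
* the same with the last user ignored (`shared_bound_all_but_one`);
* the same with the last user requesting a private file instead (`mixed_bound`);
* everybody requests a private file (`private_bound`).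

Averaging over the starting point of the order and over the two directions makes a bit of a shared
file stored at a single node count with the same weight wherever that node is
(`descending_or_ascending`), so that only the number of cached copies of shared and of private
bits matters. Each segment of the claimed curve is a convex combination of two of the resulting
inequalities, with weights that turn the two numbers of copies into the total cache size; the sign
of `b (K - 1) - 2 a` decides which combinations have nonnegative weights.

**Schemes.** The curve is piecewise linear, and memory sharing joins its corner points. Two of these
are trivial (`feasible_uncached`, `feasible_full`). At `M = a + b` every node stores its private
files and one half of each of its shared files, the two nodes concerned storing different halves.
Then each user lacks at most half a file, and one of these `K` halves can be saved, since there is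
always a group of users each of whom already knows a missing half of a member of the group
(`exists_cooperating`, `feasible_half`). The rounding in memory sharing costs a bounded number of
bits, which is negligible for large files (`isOptimalUncodedLoad_of`).
-/

namespace LocationCaching

variable {K a b B m L : ℕ}

/-! ### The acyclic bound -/

/-- The acyclic index coding bound. Let the users decode in the order of `rank`. If every bit of `V`
belongs to the request of some user and is absent from the caches of that user and of all users
that do not come after it, then `V` can be decoded from the message alone, the rest of the library
being fixed. So the message has at least as many bits as `V`. -/
theorem card_le_of_acyclic (s : Scheme K a b B m L) (pos : Fin K → Fin m → FileIdx K a b × Fin B)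
    (hpos : ∀ k W i, s.place k W i = W (pos k i).1 (pos k i).2) (d : Demand K a b)
    (rank : Fin K → ℕ) (V : Finset (FileIdx K a b × Fin B))
    (hV : ∀ x ∈ V, ∃ u, (d u).1 = x.1 ∧ ∀ v, rank v ≤ rank u → ∀ i, pos v i ≠ x) :
    V.card ≤ L := by
  let lib : (V → Bool) → Library K a b B := fun g f t =>
    if h : (f, t) ∈ V then g ⟨(f, t), h⟩ else false
  have hinj : Function.Injective fun g => s.encode d (lib g) := by
    intro g g' hgg
    -- Equal messages give equal requested files, by induction on the rank: a cached bit of `V` at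
    -- `u` belongs to the request of a user of smaller rank.
    have key : ∀ n u, rank u = n → lib g (d u) = lib g' (d u) := by
      intro n
      induction n using Nat.strong_induction_on with
      | _ n ih =>
        intro u hu
        rw [← s.decode_eq d (lib g) u, ← s.decode_eq d (lib g') u]
        have hplace : s.place u (lib g) = s.place u (lib g') := by
          funext i
          rw [hpos, hpos]
          by_cases hx : pos u i ∈ V
          · obtain ⟨v, hv, hv'⟩ := hV _ hx
            have hlt : rank v < n := by
              by_contra hcon
              exact hv' u (by omega) i rfl
            rw [← hv, ih _ hlt v rfl]
          · have : ((pos u i).1, (pos u i).2) ∉ V := hx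
            simp only [lib, dif_neg this]
        rw [hplace]
        exact congrArg _ hgg
    -- Every bit of `V` lies in a requested file, so agreement of the requests is enough.
    funext ⟨⟨f, t⟩, hx⟩
    obtain ⟨u, hu, -⟩ := hV _ hx
    have h := congrFun (key _ u rfl) t
    rw [hu] at h
    simpa only [lib, dif_pos hx] using h
  have h := Fintype.card_le_of_injective _ hinj
  simp only [Fintype.card_fun, Fintype.card_bool, Fintype.card_coe, Fintype.card_fin] at h
  exact (Nat.pow_le_pow_iff_right (by norm_num)).1 h

/-- The cache nodes that store the bit `x`. -/
def holders (pos : Fin K → Fin m → FileIdx K a b × Fin B) (x : FileIdx K a b × Fin B) :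
    Finset (Fin K) :=
  Finset.univ.filter fun v => ∃ i, pos v i = x

/-- The acyclic bound for distinct requests: user `u` contributes the bits of its file that are
stored neither in its own cache nor in that of a user of smaller or equal rank. -/
theorem sum_uncached_le (s : Scheme K a b B m L) (pos : Fin K → Fin m → FileIdx K a b × Fin B)
    (hpos : ∀ k W i, s.place k W i = W (pos k i).1 (pos k i).2) (d : Demand K a b)
    (hd : Function.Injective fun u => (d u).1) (rank : Fin K → ℕ) :
    ∑ u, ∑ t, (if ∀ v ∈ holders pos ((d u).1, t), rank u < rank v then 1 else 0) ≤ L := by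
  classical
  rw [← Fintype.sum_prod_type' (f := fun u t =>
    if ∀ v ∈ holders pos ((d u).1, t), rank u < rank v then 1 else 0), ← Finset.card_filter]
  have hinj : Function.Injective fun x : Fin K × Fin B => ((d x.1).1, x.2) := by
    rintro ⟨u, t⟩ ⟨u', t'⟩ h
    simp only [Prod.mk.injEq] at h
    rw [hd h.1, h.2]
  rw [← Finset.card_image_of_injective _ hinj]
  refine card_le_of_acyclic s pos hpos d rank _ fun x hx => ?_
  obtain ⟨⟨u, t⟩, hut, rfl⟩ := Finset.mem_image.1 hx
  refine ⟨u, rfl, fun v hv i hi => ?_⟩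
  have := (Finset.mem_filter.1 hut).2 v (by simpa [holders] using ⟨i, hi⟩)
  exact absurd this (by simpa using hv)

/-- Double counting of the pairs of a cache node and a bit stored in it. -/
theorem sum_card_holders_le (pos : Fin K → Fin m → FileIdx K a b × Fin B) :
    ∑ x, (holders pos x).card ≤ K * m := by
  classical
  calc ∑ x, (holders pos x).card
      = ∑ v : Fin K, (Finset.univ.image (pos v)).card := by
        simp only [holders, Finset.card_filter]
        rw [Finset.sum_comm]
        refine Finset.sum_congr rfl fun v _ => ?_
        rw [← Finset.card_filter]
        congr 1
        ext x
        simp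
    _ ≤ ∑ _v : Fin K, m :=
        Finset.sum_le_sum fun v _ => Finset.card_image_le.trans (by simp)
    _ = K * m := by simp

/-! ### Counting rotations of the ring -/

theorem next_eq_add_one [NeZero K] (k : Fin K) : next k = k + 1 := by
  apply Fin.ext
  simp [next, Fin.val_add]

theorem val_sub_eq_ite (x y : Fin K) :
    (x - y).val = if y.val ≤ x.val then x.val - y.val else K + x.val - y.val := by
  rw [Fin.val_sub]
  have := x.isLt
  have := y.isLt
  split_ifs with h
  · rw [show K - y.val + x.val = x.val - y.val + K by omega, Nat.add_mod_right,
      Nat.mod_eq_of_lt (by omega)]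
  · rw [Nat.mod_eq_of_lt (by omega)]
    omega

theorem val_add_one_eq_ite [NeZero K] (hK : 2 ≤ K) (x : Fin K) :
    (x + 1).val = if x.val + 1 = K then 0 else x.val + 1 := by
  have h1 : (1 : Fin K).val = 1 := by
    rw [Fin.val_one', Nat.mod_eq_of_lt (by omega)]
  rw [Fin.val_add, h1]
  have := x.isLt
  split_ifs with h
  · rw [h, Nat.mod_self]
  · exact Nat.mod_eq_of_lt (by omega)

/-- A bit of the file shared by the regions `w` and `w + 1` and stored only at node `v`. If user
`w + 1` requests it and the users decode in descending order from `c`, it counts in the acyclic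
bound when `c - (w + 1) < c - v`; if user `w` requests it and the users decode in ascending order
from `c`, it counts when `w - c < v - c`. For every `c ≠ v` one of the two happens, and the requesting user is
then not the last one in the order. -/
theorem descending_or_ascending [NeZero K] (hK : 2 ≤ K) (w v c : Fin K) (hc : c ≠ v) :
    (w + 1 ≠ c + 1 ∧ (c - (w + 1)).val < (c - v).val) ∨
      (w + 1 ≠ c ∧ (w - c).val < (v - c).val) := by
  have h1 := w.isLt
  have h2 := v.isLt
  have h3 := c.isLt
  have hw := val_add_one_eq_ite hK w
  have hc1 := val_add_one_eq_ite hK c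
  generalize w + 1 = u at *
  generalize c + 1 = c' at *
  simp only [ne_eq, Fin.ext_iff, val_sub_eq_ite] at hc ⊢
  have h4 := u.isLt
  have h5 := c'.isLt
  by_cases huc : u.val ≤ c.val <;> by_cases hvc : v.val ≤ c.val <;>
    by_cases hcv : c.val ≤ v.val <;> by_cases hcw : c.val ≤ w.val <;>
    by_cases e1 : w.val + 1 = K <;> by_cases e2 : c.val + 1 = K <;>
    simp only [huc, hvc, hcv, hcw, e1, e2, if_true, if_false] at hw hc1 ⊢ <;> omega

/-- For a bit of the file shared by `w` and `w + 1` with set of holders `T`: the number of rotations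
for which it counts in the acyclic bound with the last user left out, in both directions together,
is at least `(K - 1) (2 - |T|)`. -/
theorem le_card_rotations_not_last [NeZero K] (hK : 2 ≤ K) (T : Finset (Fin K)) (w : Fin K) :
    2 * (K - 1) ≤ (∑ c : Fin K,
        if w + 1 ≠ c + 1 ∧ ∀ v ∈ T, (c - (w + 1)).val < (c - v).val then 1 else 0) +
      (∑ c : Fin K, if w + 1 ≠ c ∧ ∀ v ∈ T, (w - c).val < (v - c).val then 1 else 0) +
      (K - 1) * T.card := by
  classical
  rcases Nat.lt_or_ge 1 T.card with hT | hT
  · have : (K - 1) * 2 ≤ (K - 1) * T.card := Nat.mul_le_mul_left _ hT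
    omega
  rcases Nat.le_one_iff_eq_zero_or_eq_one.1 hT with h0 | h1
  · rw [Finset.card_eq_zero.1 h0]
    have h1 : (∑ c : Fin K, if w + 1 ≠ c + 1 then 1 else 0) = K - 1 := by
      rw [← Finset.card_filter, Finset.filter_congr (q := fun c => c ≠ w) (by
        intro c _
        simp [eq_comm])]
      rw [Finset.filter_ne' Finset.univ w]
      simp
    have h2 : (∑ c : Fin K, if w + 1 ≠ c then 1 else 0) = K - 1 := by
      rw [← Finset.card_filter, Finset.filter_ne Finset.univ (w + 1)]
      simp
    simp only [Finset.notMem_empty, false_imp_iff, implies_true, and_true, h1, h2]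
    omega
  · obtain ⟨v, rfl⟩ := Finset.card_eq_one.1 h1
    simp only [Finset.mem_singleton, forall_eq, Finset.card_singleton, mul_one]
    have h : (Finset.univ.erase v).card ≤
        ∑ c : Fin K, ((if w + 1 ≠ c + 1 ∧ (c - (w + 1)).val < (c - v).val then 1 else 0) +
          (if w + 1 ≠ c ∧ (w - c).val < (v - c).val then 1 else 0)) := by
      rw [Finset.card_eq_sum_ones]
      refine (Finset.sum_le_sum fun c hc => ?_).trans
        (Finset.sum_le_sum_of_subset (Finset.erase_subset v Finset.univ))
      rcases descending_or_ascending hK w v c (Finset.ne_of_mem_erase hc) with h | h <;>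
        simp [h]
    rw [Finset.sum_add_distrib] at h
    simp at h ⊢
    omega

/-- Compared with `le_card_rotations_not_last`, the last user also counts. This helps only for bits
that are stored nowhere, hence the larger slope in `|T|`. -/
theorem le_card_rotations_all [NeZero K] (hK : 2 ≤ K) (T : Finset (Fin K)) (w : Fin K) :
    2 * K ≤ (∑ c : Fin K, if ∀ v ∈ T, (c - (w + 1)).val < (c - v).val then 1 else 0) +
      (∑ c : Fin K, if ∀ v ∈ T, (w - c).val < (v - c).val then 1 else 0) +
      (K + 1) * T.card := by
  classical
  rcases T.eq_empty_or_nonempty with rfl | hT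
  · simp
    omega
  · have h := le_card_rotations_not_last hK T w
    have h1 : (∑ c : Fin K,
        if w + 1 ≠ c + 1 ∧ ∀ v ∈ T, (c - (w + 1)).val < (c - v).val then 1 else 0) ≤
        ∑ c : Fin K, if ∀ v ∈ T, (c - (w + 1)).val < (c - v).val then 1 else 0 := by
      refine Finset.sum_le_sum fun c _ => ?_
      split_ifs <;> simp_all
    have h2 : (∑ c : Fin K, if w + 1 ≠ c ∧ ∀ v ∈ T, (w - c).val < (v - c).val then 1 else 0) ≤
        ∑ c : Fin K, if ∀ v ∈ T, (w - c).val < (v - c).val then 1 else 0 := by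
      refine Finset.sum_le_sum fun c _ => ?_
      split_ifs <;> simp_all
    have h3 : (K + 1) * T.card = (K - 1) * T.card + 2 * T.card := by
      rw [← add_mul]
      congr 1
      omega
    have := hT.card_pos
    omega

/-- Averaging over rotations: `f c` and `g c` bound the load for the descending and the ascending
order that start at `c`, where the file between `w` and `w + 1` is requested by `w + 1` and by `w`
respectively. -/
theorem sum_le_of_rotations [NeZero K] (f g : Fin K → Fin K → Fin B → ℕ) (p h : Fin K → Fin B → ℕ)
    (hf : ∀ c, ∑ u, ∑ t, f c u t ≤ L) (hg : ∀ c, ∑ w, ∑ t, g c w t ≤ L)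
    (hp : ∀ w t, p w t ≤ ∑ c, f c (w + 1) t + ∑ c, g c w t + h (w + 1) t) :
    ∑ w, ∑ t, p w t ≤ 2 * K * L + ∑ u, ∑ t, h u t := by
  have hshift : ∀ F : Fin K → ℕ, ∑ w, F (w + 1) = ∑ u, F u := fun F =>
    Equiv.sum_comp (Equiv.addRight 1) F
  have hsum : ∀ F : Fin K → Fin K → Fin B → ℕ, (∀ c, ∑ u, ∑ t, F c u t ≤ L) →
      ∑ u, ∑ t, ∑ c, F c u t ≤ K * L := fun F hF => by
    calc ∑ u, ∑ t, ∑ c, F c u t = ∑ c, ∑ u, ∑ t, F c u t := by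
          rw [Finset.sum_comm]
          simp_rw [Finset.sum_comm (s := (Finset.univ : Finset (Fin B)))]
          rw [Finset.sum_comm]
      _ ≤ ∑ _c : Fin K, L := Finset.sum_le_sum fun c _ => hF c
      _ = K * L := by simp
  calc ∑ w, ∑ t, p w t
      ≤ ∑ w, ∑ t, (∑ c, f c (w + 1) t + ∑ c, g c w t + h (w + 1) t) :=
        Finset.sum_le_sum fun w _ => Finset.sum_le_sum fun t _ => hp w t
    _ = ∑ u, ∑ t, ∑ c, f c u t + ∑ w, ∑ t, ∑ c, g c w t + ∑ u, ∑ t, h u t := by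
        simp only [Finset.sum_add_distrib]
        rw [hshift fun u => ∑ t, ∑ c, f c u t, hshift fun u => ∑ t, h u t]
    _ ≤ K * L + K * L + ∑ u, ∑ t, h u t := by
        gcongr
        · exact hsum f hf
        · exact hsum g hg
    _ = _ := by ring

/-! ### Lower bounds for families of demands -/

theorem shared_left_mem (k : Fin K) (j : Fin a) : (k, Sum.inl j) ∈ demandSet K a b k :=
  Or.inl (Or.inl ⟨j, rfl⟩)

theorem private_mem (k : Fin K) (j : Fin b) : (k, Sum.inr j) ∈ demandSet K a b k :=
  Or.inl (Or.inr ⟨j, rfl⟩)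

theorem shared_right_mem [NeZero K] (k : Fin K) (j : Fin a) :
    (k + 1, Sum.inl j) ∈ demandSet K a b k :=
  Or.inr ⟨j, by rw [next_eq_add_one]⟩

theorem sum_uncached_left_le (s : Scheme K a b B m L)
    (pos : Fin K → Fin m → FileIdx K a b × Fin B)
    (hpos : ∀ k W i, s.place k W i = W (pos k i).1 (pos k i).2)
    (j : Fin a) (rank : Fin K → ℕ) :
    ∑ u, ∑ t, (if ∀ v ∈ holders pos ((u, Sum.inl j), t), rank u < rank v then 1 else 0) ≤ L :=
  sum_uncached_le s pos hpos (fun u => ⟨(u, Sum.inl j), shared_left_mem u j⟩)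
    (fun _ _ h => congrArg Prod.fst h) rank

theorem sum_uncached_right_le [NeZero K] (s : Scheme K a b B m L)
    (pos : Fin K → Fin m → FileIdx K a b × Fin B)
    (hpos : ∀ k W i, s.place k W i = W (pos k i).1 (pos k i).2)
    (j : Fin a) (rank : Fin K → ℕ) :
    ∑ u, ∑ t, (if ∀ v ∈ holders pos ((u + 1, Sum.inl j), t), rank u < rank v then 1 else 0) ≤ L :=
  sum_uncached_le s pos hpos (fun u => ⟨(u + 1, Sum.inl j), shared_right_mem u j⟩)
    (fun u u' h => by simpa using h) rank

/-- All users request files shared with the same neighbour, and all of them count. -/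
theorem shared_bound_all_users [NeZero K] (s : Scheme K a b B m L)
    (pos : Fin K → Fin m → FileIdx K a b × Fin B)
    (hpos : ∀ k W i, s.place k W i = W (pos k i).1 (pos k i).2)
    (hK : 2 ≤ K) (j : Fin a) :
    2 * K * (K * B) ≤
      2 * K * L + ∑ u, ∑ t, (K + 1) * (holders pos ((u, Sum.inl j), t)).card := by
  refine le_trans (le_of_eq ?_) (sum_le_of_rotations (p := fun _ _ => 2 * K) _ _ _
    (fun c => sum_uncached_left_le s pos hpos j fun u => (c - u).val)
    (fun c => sum_uncached_right_le s pos hpos j fun w => (w - c).val)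
    fun w t => le_card_rotations_all hK _ w)
  simp
  ring

/-- The demands of `shared_bound_all_users` with the last user of each order left out, which
lowers the price of a cached copy from `K + 1` to `K - 1`. -/
theorem shared_bound_all_but_one [NeZero K] (s : Scheme K a b B m L)
    (pos : Fin K → Fin m → FileIdx K a b × Fin B)
    (hpos : ∀ k W i, s.place k W i = W (pos k i).1 (pos k i).2)
    (hK : 2 ≤ K) (j : Fin a) :
    2 * (K - 1) * (K * B) ≤
      2 * K * L + ∑ u, ∑ t, (K - 1) * (holders pos ((u, Sum.inl j), t)).card := by
  refine le_trans (le_of_eq ?_) (sum_le_of_rotations (p := fun _ _ => 2 * (K - 1)) _ _ _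
    (fun c => sum_uncached_left_le s pos hpos j fun u => (c - u).val)
    (fun c => sum_uncached_right_le s pos hpos j fun w => (w - c).val)
    fun w t => (le_card_rotations_not_last hK (holders pos ((w + 1, Sum.inl j), t)) w).trans ?_)
  · simp
    ring
  · gcongr with c _ c _
    all_goals split_ifs <;> simp_all

/-- All users request private files; only the bits stored nowhere are counted. -/
theorem private_bound (s : Scheme K a b B m L)
    (pos : Fin K → Fin m → FileIdx K a b × Fin B)
    (hpos : ∀ k W i, s.place k W i = W (pos k i).1 (pos k i).2)
    (j : Fin b) :
    ∑ u, ∑ t, (if holders pos ((u, Sum.inr j), t) = ∅ then 1 else 0) ≤ L := by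
  have h := sum_uncached_le s pos hpos (fun u => ⟨(u, Sum.inr j), private_mem u j⟩)
    (fun _ _ h => congrArg Prod.fst h) fun _ => 0
  simpa [Finset.eq_empty_iff_forall_notMem] using h

theorem mixed_left_bound (s : Scheme K a b B m L)
    (pos : Fin K → Fin m → FileIdx K a b × Fin B)
    (hpos : ∀ k W i, s.place k W i = W (pos k i).1 (pos k i).2)
    (j : Fin a) (j' : Fin b) (q : Fin K) (rank : Fin K → ℕ) :
    ∑ u, ∑ t, ((if u = q then (if holders pos ((u, Sum.inr j'), t) = ∅ then 1 else 0) else 0) +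
      (if u ≠ q ∧ ∀ v ∈ holders pos ((u, Sum.inl j), t), rank u < rank v then 1 else 0)) ≤ L := by
  refine le_trans ?_ (sum_uncached_le s pos hpos
    (fun u => if u = q then ⟨(u, Sum.inr j'), private_mem u j'⟩
      else ⟨(u, Sum.inl j), shared_left_mem u j⟩) ?_ rank)
  · refine Finset.sum_le_sum fun u _ => Finset.sum_le_sum fun t _ => ?_
    by_cases hu : u = q
    · by_cases he : holders pos ((u, Sum.inr j'), t) = ∅ <;> simp [hu] at he ⊢ <;> simp [he]
    · simp [hu]
  · intro u u' h
    by_cases hu : u = q <;> by_cases hu' : u' = q <;> simp_all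

theorem mixed_right_bound [NeZero K] (s : Scheme K a b B m L)
    (pos : Fin K → Fin m → FileIdx K a b × Fin B)
    (hpos : ∀ k W i, s.place k W i = W (pos k i).1 (pos k i).2)
    (j : Fin a) (j' : Fin b) (q : Fin K) (rank : Fin K → ℕ) :
    ∑ u, ∑ t, ((if u + 1 = q then (if holders pos ((u, Sum.inr j'), t) = ∅ then 1 else 0) else 0) +
      (if u + 1 ≠ q ∧ ∀ v ∈ holders pos ((u + 1, Sum.inl j), t), rank u < rank v
        then 1 else 0)) ≤ L := by
  refine le_trans ?_ (sum_uncached_le s pos hpos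
    (fun u => if u + 1 = q then ⟨(u, Sum.inr j'), private_mem u j'⟩
      else ⟨(u + 1, Sum.inl j), shared_right_mem u j⟩) ?_ rank)
  · refine Finset.sum_le_sum fun u _ => Finset.sum_le_sum fun t _ => ?_
    by_cases hu : u + 1 = q
    · by_cases he : holders pos ((u, Sum.inr j'), t) = ∅ <;> simp [hu, he]
    · simp [hu]
  · intro u u' h
    by_cases hu : u + 1 = q <;> by_cases hu' : u' + 1 = q <;> simp_all

/-- All users but the last one in the order request shared files, the last one a private file. The
last shared request, which meets every cache on the ring, is thus replaced by a private one. -/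
theorem mixed_bound [NeZero K] (s : Scheme K a b B m L)
    (pos : Fin K → Fin m → FileIdx K a b × Fin B)
    (hpos : ∀ k W i, s.place k W i = W (pos k i).1 (pos k i).2)
    (hK : 2 ≤ K) (j : Fin a) (j' : Fin b) :
    2 * (K - 1) * (K * B) +
        2 * ∑ u, ∑ t, (if holders pos ((u, Sum.inr j'), t) = ∅ then 1 else 0) ≤
      2 * K * L + ∑ u, ∑ t, (K - 1) * (holders pos ((u, Sum.inl j), t)).card := by
  set E : Fin K → Fin B → ℕ := fun u t => if holders pos ((u, Sum.inr j'), t) = ∅ then 1 else 0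
    with hE
  refine le_trans (le_of_eq ?_) (sum_le_of_rotations
    (p := fun w t => 2 * (K - 1) + (E (w + 1) t + E w t)) _ _ _
    (fun c => mixed_left_bound s pos hpos j j' (c + 1) fun u => (c - u).val)
    (fun c => mixed_right_bound s pos hpos j j' c fun w => (w - c).val)
    fun w t => ?_)
  · have hshift : ∑ w, ∑ t, E (w + 1) t = ∑ u, ∑ t, E u t :=
      Equiv.sum_comp (Equiv.addRight 1) fun u => ∑ t, E u t
    simp only [Finset.sum_add_distrib, hshift, Finset.sum_const, Finset.card_univ,
      Fintype.card_fin, smul_eq_mul]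
    ring
  · have h := le_card_rotations_not_last hK (holders pos ((w + 1, Sum.inl j), t)) w
    rw [Finset.sum_add_distrib, Finset.sum_add_distrib]
    have h1 : (∑ c : Fin K, if w + 1 = c + 1 then E (w + 1) t else 0) = E (w + 1) t := by
      simp
    have h2 : (∑ c : Fin K, if w + 1 = c then E w t else 0) = E w t := by simp
    simp only [hE] at h1 h2 ⊢
    rw [h1, h2]
    omega

/-- The lower bounds summed over all files: `Cs` and `Cu` are the numbers of cached copies of bits
of shared and of private files, and `E` is the number of private bits that are stored nowhere. -/
theorem exists_storage_bounds (hK : 2 ≤ K) (s : Scheme K a b B m L) (hs : s.IsUncoded) :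
    ∃ Cs Cu E : ℝ, Cs + Cu ≤ K * m ∧
      b * (K * B) ≤ E + Cu ∧
      E ≤ b * L ∧
      a * (2 * K * (K * B)) ≤ a * (2 * K * L) + (K + 1) * Cs ∧
      a * (2 * (K - 1) * (K * B)) ≤ a * (2 * K * L) + (K - 1) * Cs ∧
      b * (a * (2 * (K - 1) * (K * B))) + a * (2 * E) ≤
        b * (a * (2 * K * L) + (K - 1) * Cs) := by
  have : NeZero K := ⟨by omega⟩
  choose pos hpos using hs
  have hK1 : ((K - 1 : ℕ) : ℝ) = K - 1 := by
    rw [Nat.cast_sub (by omega)]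
    simp
  set cs : Fin a → ℕ := fun j => ∑ u, ∑ t, (holders pos ((u, Sum.inl j), t)).card with hcs
  set cu : Fin b → ℕ := fun j => ∑ u, ∑ t, (holders pos ((u, Sum.inr j), t)).card with hcu
  set e : Fin b → ℕ := fun j =>
    ∑ u, ∑ t, (if holders pos ((u, Sum.inr j), t) = ∅ then 1 else 0) with he
  have htotal : ∑ j, cs j + ∑ j, cu j ≤ K * m := by
    refine le_trans (le_of_eq ?_) (sum_card_holders_le pos)
    simp only [Fintype.sum_prod_type, Fintype.sum_sum_type, hcs, hcu, Finset.sum_add_distrib]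
    rw [Finset.sum_comm]
    congr 1
    exact Finset.sum_comm
  have hempty : ∀ j, K * B ≤ e j + cu j := fun j => by
    calc K * B = ∑ _u : Fin K, ∑ _t : Fin B, 1 := by simp
      _ ≤ ∑ u, ∑ t, ((if holders pos ((u, Sum.inr j), t) = ∅ then 1 else 0) +
            (holders pos ((u, Sum.inr j), t)).card) := by
          refine Finset.sum_le_sum fun u _ => Finset.sum_le_sum fun t _ => ?_
          split_ifs with h
          · omega
          · have := (Finset.nonempty_iff_ne_empty.2 h).card_pos
            omega
      _ = e j + cu j := by simp only [Finset.sum_add_distrib, he, hcu]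
  have hprivate : ∀ j, e j ≤ L := private_bound s pos hpos
  have hshared : ∀ j, 2 * K * (K * B) ≤ 2 * K * L + (K + 1) * cs j := fun j => by
    simpa only [hcs, Finset.mul_sum] using shared_bound_all_users s pos hpos hK j
  have hshared' : ∀ j, 2 * (K - 1) * (K * B) ≤ 2 * K * L + (K - 1) * cs j := fun j => by
    simpa only [hcs, Finset.mul_sum] using shared_bound_all_but_one s pos hpos hK j
  have hmixed : ∀ j j', 2 * (K - 1) * (K * B) + 2 * e j' ≤ 2 * K * L + (K - 1) * cs j :=
    fun j j' => by
      simpa only [hcs, he, Finset.mul_sum] using mixed_bound s pos hpos hK j j'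
  refine ⟨((∑ j, cs j : ℕ) : ℝ), ((∑ j, cu j : ℕ) : ℝ), ((∑ j, e j : ℕ) : ℝ), ?_⟩
  rw [← hK1]
  refine ⟨by exact_mod_cast htotal, ?_, ?_, ?_, ?_, ?_⟩
  · have := Finset.sum_le_sum fun j (_ : j ∈ Finset.univ) => hempty j
    simp only [Finset.sum_add_distrib, Finset.sum_const, Finset.card_univ, Fintype.card_fin,
      smul_eq_mul] at this
    exact_mod_cast this
  · have := Finset.sum_le_sum fun j (_ : j ∈ Finset.univ) => hprivate j
    simp only [Finset.sum_const, Finset.card_univ, Fintype.card_fin, smul_eq_mul] at this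
    exact_mod_cast this
  · have := Finset.sum_le_sum fun j (_ : j ∈ Finset.univ) => hshared j
    simp only [Finset.sum_add_distrib, ← Finset.mul_sum, Finset.sum_const, Finset.card_univ,
      Fintype.card_fin, smul_eq_mul] at this
    refine le_of_eq_of_le ?_ (((Nat.cast_le (α := ℝ)).2 this).trans (le_of_eq ?_)) <;>
      push_cast <;> ring
  · have := Finset.sum_le_sum fun j (_ : j ∈ Finset.univ) => hshared' j
    simp only [Finset.sum_add_distrib, ← Finset.mul_sum, Finset.sum_const, Finset.card_univ,
      Fintype.card_fin, smul_eq_mul] at this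
    refine le_of_eq_of_le ?_ (((Nat.cast_le (α := ℝ)).2 this).trans (le_of_eq ?_)) <;>
      push_cast <;> ring
  · have := Finset.sum_le_sum fun j' (_ : j' ∈ Finset.univ) =>
      Finset.sum_le_sum fun j (_ : j ∈ Finset.univ) => hmixed j j'
    simp only [Finset.sum_add_distrib, ← Finset.mul_sum, Finset.sum_const, Finset.card_univ,
      Fintype.card_fin, smul_eq_mul] at this
    refine le_of_eq_of_le ?_ (((Nat.cast_le (α := ℝ)).2 this).trans (le_of_eq ?_)) <;>
      push_cast <;> ring

/-! ### Schemes at the corner points -/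

/-- Some scheme with uncoded placement has exactly the given numbers of bits. -/
def Feasible (K a b B m L : ℕ) : Prop := ∃ s : Scheme K a b B m L, s.IsUncoded

/-- Decoders need not be written down: it is enough that cache content and message determine the
requested file. Cache positions and message bits may be indexed by any finite types. -/
theorem feasible_of_determines {ι : Type*} [Fintype ι] (hm : Fintype.card ι = m)
    (pos : Fin K → ι → FileIdx K a b × Fin B) {κ : Demand K a b → Type*} [∀ d, Fintype (κ d)]
    (hL : ∀ d, Fintype.card (κ d) = L) (enc : (d : Demand K a b) → Library K a b B → κ d → Bool)
    (hdec : ∀ d k W W', (∀ i, W (pos k i).1 (pos k i).2 = W' (pos k i).1 (pos k i).2) →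
      enc d W = enc d W' → W (d k) = W' (d k)) : Feasible K a b B m L := by
  classical
  let e : Fin m ≃ ι := (Fintype.equivFinOfCardEq hm).symm
  let e' : (d : Demand K a b) → Fin L ≃ κ d := fun d => (Fintype.equivFinOfCardEq (hL d)).symm
  let place : Fin K → Library K a b B → Fin m → Bool :=
    fun k W i => W (pos k (e i)).1 (pos k (e i)).2
  let encode : Demand K a b → Library K a b B → Fin L → Bool := fun d W l => enc d W (e' d l)
  refine ⟨⟨place, encode, fun k d c y =>
    if h : ∃ W, place k W = c ∧ encode d W = y then h.choose (d k) else fun _ => false, ?_⟩,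
    fun k => ⟨fun i => pos k (e i), fun _ _ => rfl⟩⟩
  intro d W k
  have h : ∃ W', place k W' = place k W ∧ encode d W' = encode d W := ⟨W, rfl, rfl⟩
  rw [dif_pos h]
  refine hdec d k _ _ (fun i => ?_) ?_
  · simpa [place] using congrFun h.choose_spec.1 (e.symm i)
  · funext l
    simpa [encode] using congrFun h.choose_spec.2 ((e' d).symm l)

/-- Memory sharing: two schemes applied to disjoint parts of each file. -/
theorem Feasible.add {B₁ B₂ m₁ m₂ L₁ L₂ : ℕ} (h₁ : Feasible K a b B₁ m₁ L₁)
    (h₂ : Feasible K a b B₂ m₂ L₂) : Feasible K a b (B₁ + B₂) (m₁ + m₂) (L₁ + L₂) := by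
  obtain ⟨s₁, hs₁⟩ := h₁
  obtain ⟨s₂, hs₂⟩ := h₂
  choose p₁ hp₁ using hs₁
  choose p₂ hp₂ using hs₂
  let l₁ : Library K a b (B₁ + B₂) → Library K a b B₁ := fun W f t => W f (Fin.castAdd B₂ t)
  let l₂ : Library K a b (B₁ + B₂) → Library K a b B₂ := fun W f t => W f (Fin.natAdd B₁ t)
  refine feasible_of_determines (ι := Fin m₁ ⊕ Fin m₂) (κ := fun _ => Fin L₁ ⊕ Fin L₂) (by simp)
    (fun k => Sum.elim (fun i => ((p₁ k i).1, Fin.castAdd B₂ (p₁ k i).2))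
      fun i => ((p₂ k i).1, Fin.natAdd B₁ (p₂ k i).2)) (by simp)
    (fun d W => Sum.elim (s₁.encode d (l₁ W)) (s₂.encode d (l₂ W))) ?_
  intro d k W W' hc he
  have h₁ : l₁ W (d k) = l₁ W' (d k) := by
    rw [← s₁.decode_eq d (l₁ W) k, ← s₁.decode_eq d (l₁ W') k]
    congr 1
    · funext i
      rw [hp₁, hp₁]
      exact hc (Sum.inl i)
    · funext l
      exact congrFun he (Sum.inl l)
  have h₂ : l₂ W (d k) = l₂ W' (d k) := by
    rw [← s₂.decode_eq d (l₂ W) k, ← s₂.decode_eq d (l₂ W') k]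
    congr 1
    · funext i
      rw [hp₂, hp₂]
      exact hc (Sum.inr i)
    · funext l
      exact congrFun he (Sum.inr l)
  funext t
  refine Fin.addCases (fun t => congrFun h₁ t) (fun t => congrFun h₂ t) t

theorem Feasible.nsmul (h : Feasible K a b B m L) (n : ℕ) :
    Feasible K a b (n * B) (n * m) (n * L) := by
  induction n with
  | zero =>
    simp only [zero_mul]
    exact feasible_of_determines (ι := Fin 0) (κ := fun _ => Fin 0) (by simp)
      (fun _ i => i.elim0) (by simp) (fun _ _ i => i.elim0) fun _ _ _ _ _ _ =>
        funext fun t => t.elim0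
  | succ n ih =>
    simp only [Nat.succ_mul]
    exact ih.add h

/-- With empty caches, every requested file is sent. -/
theorem feasible_uncached : Feasible K a b 1 0 K :=
  feasible_of_determines (ι := Fin 0) (κ := fun _ => Fin K) (by simp)
    (fun _ i => i.elim0) (by simp) (fun d W k => W (d k) 0) fun d k W W' _ h => by
      funext t
      rw [Subsingleton.elim t 0]
      exact congrFun h k

/-- With the whole demand set cached, nothing is sent. -/
theorem feasible_full : Feasible K a b 1 (2 * a + b) 0 := by
  refine feasible_of_determines (ι := (Fin a ⊕ Fin b) ⊕ Fin a) (κ := fun _ => Fin 0)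
    (by simp; ring)
    (fun k => Sum.elim (fun i => ((k, i), 0)) fun j => ((next k, Sum.inl j), 0)) (by simp)
    (fun _ _ i => i.elim0) fun d k W W' hc _ => ?_
  funext t
  rw [Subsingleton.elim t 0]
  obtain ⟨f, hf⟩ := d k
  rcases hf with (⟨j, rfl⟩ | ⟨j, rfl⟩) | ⟨j, rfl⟩
  · exact hc (Sum.inl (Sum.inl j))
  · exact hc (Sum.inl (Sum.inr j))
  · exact hc (Sum.inr j)

/-- With the caches of `halfCache`, the bit of the request of user `k` that its own cache may lack:
bit `1` of a file shared with the left-hand neighbour, bit `0` of one shared with the right-hand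
neighbour. For a private file, whose two bits are cached, the choice of `0` is immaterial. -/
def missing (d : Demand K a b) (k : Fin K) : Fin 2 :=
  if ∃ j : Fin a, (d k).1 = (k, Sum.inl j) then 1 else 0

/-- The cache of node `k` for files of two bits: bit `0` of the files shared with the left-hand
neighbour, bit `1` of those shared with the right-hand neighbour, and all private files of `k`. -/
def halfCache (K a b : ℕ) (k : Fin K) :
    (Fin a ⊕ Fin a) ⊕ (Fin b × Fin 2) → FileIdx K a b × Fin 2 :=
  Sum.elim (Sum.elim (fun j => ((k, Sum.inl j), 0)) fun j => ((next k, Sum.inl j), 1))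
    fun p => ((k, Sum.inr p.1), p.2)

theorem halfCache_of_ne_missing (d : Demand K a b) (k : Fin K) (t : Fin 2) (ht : t ≠ missing d k) :
    ∃ i, halfCache K a b k i = ((d k).1, t) := by
  unfold missing at ht
  rcases (d k).2 with (⟨j, hj⟩ | ⟨j, hj⟩) | ⟨j, hj⟩
  · refine ⟨Sum.inl (Sum.inl j), ?_⟩
    rw [if_pos ⟨j, hj.symm⟩] at ht
    have : t = 0 := by omega
    simp [halfCache, this, ← hj]
  · exact ⟨Sum.inr (j, t), by rw [← hj]; rfl⟩
  · split_ifs at ht with h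
    · refine ⟨Sum.inl (Sum.inl j), ?_⟩
      obtain ⟨j', h⟩ := h
      have h1 : next k = k := congrArg Prod.fst (hj.trans h)
      have : t = 0 := by omega
      simp [halfCache, ← hj, h1, this]
    · refine ⟨Sum.inl (Sum.inr j), ?_⟩
      have : t = 1 := by omega
      simp [halfCache, ← hj, this]

/-- For every demand there is a nonempty set `P` of users each of whom stores the missing bit of
some member of `P`. It is a single user with a private request, or two neighbours that request files
shared with each other, or else the whole ring, all requests then pointing the same way. -/
theorem exists_cooperating (hK : 2 ≤ K) (d : Demand K a b) :
    ∃ (P : Finset (Fin K)) (p : Fin K), p ∈ P ∧ ∀ k ∈ P, ∃ j ∈ P, ∃ i,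
      halfCache K a b k i = ((d j).1, missing d j) := by
  classical
  have : NeZero K := ⟨by omega⟩
  have hne : ∀ k : Fin K, k + 1 ≠ k := fun k h => by
    have h1 := val_add_one_eq_ite hK k
    have h2 := congrArg Fin.val h
    split_ifs at h1 <;> omega
  let l : Fin K → Prop := fun k => ∃ j, (d k).1 = (k, Sum.inl j)
  let r : Fin K → Prop := fun k => ∃ j, (d k).1 = (k + 1, Sum.inl j)
  have hl : ∀ k, l (k + 1) → ∃ i, halfCache K a b k i = ((d (k + 1)).1, missing d (k + 1)) := by
    rintro k ⟨j, hj⟩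
    refine ⟨Sum.inl (Sum.inr j), ?_⟩
    have : missing d (k + 1) = 1 := if_pos ⟨j, hj⟩
    rw [this, hj]
    simp [halfCache, next_eq_add_one]
  have hr : ∀ k, r k → ∃ i, halfCache K a b (k + 1) i = ((d k).1, missing d k) := by
    rintro k ⟨j, hj⟩
    refine ⟨Sum.inl (Sum.inl j), ?_⟩
    have : missing d k = 0 := if_neg fun ⟨j', h⟩ => hne k (congrArg Prod.fst (hj.symm.trans h))
    rw [this, hj]
    simp [halfCache]
  -- A user that requests a private file knows its own missing bit.
  by_cases h1 : ∃ k, ¬ l k ∧ ¬ r k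
  · obtain ⟨k, hlk, hrk⟩ := h1
    refine ⟨{k}, k, by simp, fun k' hk' => ⟨k, by simp, ?_⟩⟩
    rw [Finset.mem_singleton.1 hk']
    rcases (d k).2 with (⟨j, hj⟩ | ⟨j, hj⟩) | ⟨j, hj⟩
    · exact absurd ⟨j, hj.symm⟩ hlk
    · exact ⟨Sum.inr (j, missing d k), by rw [← hj]; rfl⟩
    · exact absurd ⟨j, by rw [← hj, next_eq_add_one]⟩ hrk
  push Not at h1
  -- Two neighbours whose requests point at each other know each other's missing bits.
  by_cases h2 : ∃ k, r k ∧ l (k + 1)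
  · obtain ⟨k, hrk, hlk⟩ := h2
    refine ⟨{k, k + 1}, k, by simp, fun k' hk' => ?_⟩
    rcases Finset.mem_insert.1 hk' with rfl | hk'
    · exact ⟨k' + 1, by simp, hl k' hlk⟩
    · rw [Finset.mem_singleton.1 hk']
      exact ⟨k, by simp, hr k hrk⟩
  push Not at h2
  refine ⟨Finset.univ, 0, Finset.mem_univ _, fun k _ => ?_⟩
  -- Now a request pointing right forces the next one to point right, and so on around the ring.
  by_cases h3 : ∃ k₀, r k₀
  · obtain ⟨k₀, h₀⟩ := h3
    have hall : ∀ (n : ℕ) k, (k - k₀).val = n → r k := by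
      intro n
      induction n with
      | zero =>
        intro k hk
        have : k = k₀ := by
          apply Fin.ext
          rw [val_sub_eq_ite] at hk
          split_ifs at hk <;> omega
        rwa [this]
      | succ n ih =>
        intro k hk
        have hlk := h2 (k - 1) (ih (k - 1) ?_)
        · rw [sub_add_cancel] at hlk
          exact h1 k hlk
        · have h4 := val_add_one_eq_ite hK (k - 1)
          rw [sub_add_cancel] at h4
          have := (k - 1).isLt
          have := k₀.isLt
          rw [val_sub_eq_ite] at hk ⊢
          split_ifs at hk h4 ⊢ <;> omega
    refine ⟨k - 1, Finset.mem_univ _, ?_⟩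
    have := hr (k - 1) (hall _ _ rfl)
    rwa [sub_add_cancel] at this
  · refine ⟨k + 1, Finset.mem_univ _, hl k ?_⟩
    by_contra hlk
    exact h3 ⟨_, h1 _ hlk⟩

/-- One of the `K` missing bits is saved: for the set `P` of `exists_cooperating` and `p ∈ P`, the
message consists of the sums with the missing bit of `p` of those of the other members of `P`, and
of the plain missing bits of the users outside `P`. A member of `P` knows one missing bit of `P`,
hence all of them. -/
theorem feasible_half (hK : 2 ≤ K) : Feasible K a b 2 (2 * (a + b)) (K - 1) := by
  classical
  choose P p hp hP using exists_cooperating (a := a) (b := b) hK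
  let x : Demand K a b → Library K a b 2 → Fin K → Bool := fun d W k => W (d k) (missing d k)
  refine feasible_of_determines (κ := fun d => {k : Fin K // k ≠ p d}) (by simp; ring)
    (halfCache K a b) (fun d => by simp)
    (fun d W k => xor (x d W k) (if k.1 ∈ P d then x d W (p d) else false)) ?_
  intro d k W W' hc he
  have hx : ∀ k, xor (x d W k) (if k ∈ P d then x d W (p d) else false) =
      xor (x d W' k) (if k ∈ P d then x d W' (p d) else false) := fun k => by
    -- The sum for `p` itself is zero and need not be sent.
    by_cases hk : k = p d
    · simp [hk, hp]
    · exact congrFun he ⟨k, hk⟩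
  have hknown : ∀ f t, (∃ i, halfCache K a b k i = (f, t)) → W f t = W' f t := by
    rintro f t ⟨i, hi⟩
    have := hc i
    rwa [hi] at this
  funext t
  by_cases ht : t = missing d k
  · subst ht
    change x d W k = x d W' k
    have hk := hx k
    by_cases hkP : k ∈ P d
    · obtain ⟨j, hj, hj'⟩ := hP d k hkP
      have h1 : x d W j = x d W' j := hknown _ _ hj'
      have h2 := hx j
      rw [if_pos hj, if_pos hj, h1] at h2
      rw [if_pos hkP, if_pos hkP, Bool.xor_right_inj.1 h2] at hk
      exact Bool.xor_left_inj.1 hk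
    · simpa [hkP] using hk
  · exact hknown _ _ (halfCache_of_ne_missing d k t ht)

/-! ### Memory sharing and large files -/

theorem feasible_mixture (hK : 2 ≤ K) (x y z : ℕ) :
    Feasible K a b (x + y * 2 + z) (y * (2 * (a + b)) + z * (2 * a + b)) (x * K + y * (K - 1)) := by
  have h := ((feasible_uncached.nsmul x).add ((feasible_half hK).nsmul y)).add
    ((feasible_full (K := K) (a := a) (b := b)).nsmul z)
  simpa using h

theorem uncodedAchievable_mixture (hK : 2 ≤ K) (x y z : ℕ) {M R : ℝ} (hB : x + y * 2 + z = B)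
    (hM : y * (2 * (a + b : ℝ)) + z * (2 * a + b) ≤ M * B)
    (hR : x * K + y * (K - 1 : ℝ) ≤ R * B) : UncodedAchievable K a b B M R := by
  subst hB
  refine ⟨_, _, ?_, ?_, feasible_mixture hK x y z⟩
  · push_cast at hM ⊢
    exact hM
  · push_cast [Nat.cast_sub (show 1 ≤ K by omega)] at hR ⊢
    exact hR

/-- A lower bound on the load is optimal if it is attained up to a bounded number of bits for all
large file sizes. -/
theorem isOptimalUncodedLoad_of {M r : ℝ}
    (hle : ∀ B R, 0 < B → UncodedAchievable K a b B M R → r ≤ R) {c : ℝ}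
    (hach : ∀ᶠ B : ℕ in Filter.atTop, ∀ R : ℝ, r * B + c ≤ R * B → UncodedAchievable K a b B M R) :
    IsOptimalUncodedLoad K a b M r := by
  have h : ∀ ε : ℝ, 0 < ε → ∀ᶠ B : ℕ in Filter.atTop, UncodedAchievable K a b B M (r + ε) := by
    intro ε hε
    have hlarge : ∀ᶠ B : ℕ in Filter.atTop, c ≤ ε * B :=
      (tendsto_natCast_atTop_atTop.const_mul_atTop hε).eventually_ge_atTop c
    filter_upwards [hach, hlarge] with B h₁ h₂
    exact h₁ _ (by linarith)
  refine ⟨⟨fun R ⟨B, hB, hR⟩ => hle B R hB hR, fun w hw => ?_⟩, h⟩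
  refine le_of_forall_pos_le_add fun ε hε => ?_
  obtain ⟨B, hB, hB0⟩ := ((h ε hε).and (Filter.eventually_gt_atTop 0)).exists
  exact hw ⟨B, hB0, hB⟩

/-! ### The converse in terms of the load -/

theorem exists_storage_bounds_of_achievable (hK : 2 ≤ K) {M R : ℝ}
    (h : UncodedAchievable K a b B M R) : ∃ Cs Cu E L : ℝ, L ≤ R * B ∧ Cs + Cu ≤ K * (M * B) ∧
      b * (K * B) ≤ E + Cu ∧
      E ≤ b * L ∧
      a * (2 * K * (K * B)) ≤ a * (2 * K * L) + (K + 1) * Cs ∧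
      a * (2 * (K - 1) * (K * B)) ≤ a * (2 * K * L) + (K - 1) * Cs ∧
      b * (a * (2 * (K - 1) * (K * B))) + a * (2 * E) ≤
        b * (a * (2 * K * L) + (K - 1) * Cs) := by
  obtain ⟨m, L, hm, hL, s, hs⟩ := h
  obtain ⟨Cs, Cu, E, h, h'⟩ := exists_storage_bounds hK s hs
  exact ⟨Cs, Cu, E, L, hL, h.trans (by gcongr), h'⟩

/-- The weights `2 a - b (K - 1)` and `K + 1` on `shared_bound_all_users` and `mixed_bound` make the
total cache size appear. -/
theorem le_load_first_segment (hK : 2 ≤ K) (hab : (b : ℝ) * (K - 1) < 2 * a) {M R : ℝ} (hB : 0 < B)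
    (h : UncodedAchievable K a b B M R) : K - (K + 1) / (2 * ((a : ℝ) + b)) * M ≤ R := by
  obtain ⟨Cs, Cu, E, L, hL, hC, hE, hP, hA, hD, hX⟩ := exists_storage_bounds_of_achievable hK h
  have hK' : (2 : ℝ) ≤ K := by exact_mod_cast hK
  have hB' : (0 : ℝ) < B := by exact_mod_cast hB
  have hb : (0 : ℝ) ≤ b := Nat.cast_nonneg b
  have ha : (0 : ℝ) < a := by nlinarith
  have h1 := mul_le_mul_of_nonneg_left hA (sub_nonneg.2 hab.le)
  have h2 := mul_le_mul_of_nonneg_left hX (show (0 : ℝ) ≤ K + 1 by linarith)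
  have h3 := mul_le_mul_of_nonneg_left hE (show (0 : ℝ) ≤ 2 * a * (K + 1) by positivity)
  have h4 := mul_le_mul_of_nonneg_left hC (show (0 : ℝ) ≤ 2 * a * (K + 1) by positivity)
  have h5 := mul_le_mul_of_nonneg_left hL (show (0 : ℝ) ≤ 4 * K * a * (a + b) by positivity)
  have h6 : 2 * (a : ℝ) * K * B * (2 * (a + b) * K) ≤
      2 * a * K * B * (2 * (a + b) * R + (K + 1) * M) := by linarith
  have h7 := le_of_mul_le_mul_left h6 (by positivity)
  have : (0 : ℝ) < 2 * (a + b) := by positivity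
  rw [sub_le_iff_le_add, div_mul_eq_mul_div, ← sub_le_iff_le_add', le_div_iff₀ this]
  linarith

/-- Here the weights are `2 a - b (K - 1)` and `K - 1`, on `shared_bound_all_but_one` and
`mixed_bound`. -/
theorem le_load_second_segment (hK : 2 ≤ K) (hab : (b : ℝ) * (K - 1) < 2 * a) {M R : ℝ} (hB : 0 < B)
    (h : UncodedAchievable K a b B M R) :
    ((K : ℝ) - 1) * (2 * a + b) / (2 * a) - ((K : ℝ) - 1) / (2 * a) * M ≤ R := by
  obtain ⟨Cs, Cu, E, L, hL, hC, hE, hP, hA, hD, hX⟩ := exists_storage_bounds_of_achievable hK h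
  have hK' : (2 : ℝ) ≤ K := by exact_mod_cast hK
  have hK1 : (0 : ℝ) ≤ K - 1 := by linarith
  have hB' : (0 : ℝ) < B := by exact_mod_cast hB
  have hb : (0 : ℝ) ≤ b := Nat.cast_nonneg b
  have ha : (0 : ℝ) < a := by nlinarith
  have h1 := mul_le_mul_of_nonneg_left hD (sub_nonneg.2 hab.le)
  have h2 := mul_le_mul_of_nonneg_left hX hK1
  have h3 := mul_le_mul_of_nonneg_left hE (show (0 : ℝ) ≤ 2 * a * (K - 1) by positivity)
  have h4 := mul_le_mul_of_nonneg_left hC (show (0 : ℝ) ≤ 2 * a * (K - 1) by positivity)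
  have h5 := mul_le_mul_of_nonneg_left hL (show (0 : ℝ) ≤ 4 * K * a * a by positivity)
  have h6 : 2 * (a : ℝ) * K * B * ((K - 1) * (2 * a + b)) ≤
      2 * a * K * B * (2 * a * R + (K - 1) * M) := by linarith
  have h7 := le_of_mul_le_mul_left h6 (by positivity)
  rw [div_mul_eq_mul_div, ← sub_div, div_le_iff₀ (by positivity)]
  linarith

/-- Here `b (K - 1) - 2 a` is the weight of `private_bound`, that of `mixed_bound` being `1`. -/
theorem le_load_single_segment (hK : 2 ≤ K) (hpos : 0 < a + b) (hab : 2 * (a : ℝ) ≤ b * (K - 1))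
    {M R : ℝ} (hB : 0 < B) (h : UncodedAchievable K a b B M R) :
    (K : ℝ) - K / (2 * a + b) * M ≤ R := by
  obtain ⟨Cs, Cu, E, L, hL, hC, hE, hP, hA, hD, hX⟩ := exists_storage_bounds_of_achievable hK h
  have hK' : (2 : ℝ) ≤ K := by exact_mod_cast hK
  have hK1 : (0 : ℝ) < K - 1 := by linarith
  have hB' : (0 : ℝ) < B := by exact_mod_cast hB
  have ha : (0 : ℝ) ≤ a := Nat.cast_nonneg a
  have hpos' : (0 : ℝ) < a + b := by exact_mod_cast hpos
  have hb : (0 : ℝ) < b := by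
    rcases (Nat.cast_nonneg (α := ℝ) b).eq_or_lt with h0 | h0
    · rw [← h0] at hab hpos'
      linarith
    · exact h0
  have h1 := mul_le_mul_of_nonneg_left hP (sub_nonneg.2 hab)
  have h3 := mul_le_mul_of_nonneg_left hE (show (0 : ℝ) ≤ b * (K - 1) by positivity)
  have h4 := mul_le_mul_of_nonneg_left hC (show (0 : ℝ) ≤ b * (K - 1) by positivity)
  have h5 := mul_le_mul_of_nonneg_left hL (show (0 : ℝ) ≤ b * (K - 1) * (2 * a + b) by positivity)
  have h6 : (b : ℝ) * (K - 1) * B * ((2 * a + b) * K) ≤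
      b * (K - 1) * B * ((2 * a + b) * R + K * M) := by linarith
  have h7 := le_of_mul_le_mul_left h6 (by positivity)
  have : (0 : ℝ) < 2 * a + b := by positivity
  rw [sub_le_iff_le_add, div_mul_eq_mul_div, ← sub_le_iff_le_add', le_div_iff₀ this]
  linarith

/-! ### The optimal loads -/

/-- Memory sharing between the uncached and the half-cache scheme. -/
theorem isOptimalUncodedLoad_first_segment (hK : 2 ≤ K) (hab : 0 < a + b)
    (hlt : (b : ℝ) * (K - 1) < 2 * a) {M : ℝ} (hM0 : 0 ≤ M) (hM : M ≤ a + b) :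
    IsOptimalUncodedLoad K a b M (K - (K + 1) / (2 * ((a : ℝ) + b)) * M) := by
  have hab' : (0 : ℝ) < a + b := by exact_mod_cast hab
  refine isOptimalUncodedLoad_of (fun B R hB h => le_load_first_segment hK hlt hB h) (c := K + 1)
    (Filter.Eventually.of_forall fun B R hR => ?_)
  set q : ℝ := M * B / (2 * (a + b)) with hq
  have hq0 : 0 ≤ q := by positivity
  have hqM : q * (2 * (a + b)) = M * B := div_mul_cancel₀ _ (by positivity)
  have hqB : q * 2 ≤ B := by
    have h1 : M * B ≤ (a + b) * B := by gcongr
    have h2 : (a + b : ℝ) * (q * 2) ≤ (a + b) * B := by linarith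
    exact le_of_mul_le_mul_left h2 hab'
  have hy := Nat.floor_le hq0
  have hy' := (Nat.lt_floor_add_one q).le
  have hyB : ⌊q⌋₊ * 2 ≤ B := by
    have : (⌊q⌋₊ : ℝ) * 2 ≤ B := by linarith
    exact_mod_cast this
  refine uncodedAchievable_mixture hK (B - ⌊q⌋₊ * 2) ⌊q⌋₊ 0 (by omega) ?_ ?_
  · have := mul_le_mul_of_nonneg_right hy (show (0 : ℝ) ≤ 2 * (a + b) by positivity)
    push_cast
    linarith
  · have h1 : ((K : ℝ) + 1) / (2 * (a + b)) * M * B = (K + 1) * q := by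
      rw [hq]
      ring
    have h2 := mul_le_mul_of_nonneg_left hy' (show (0 : ℝ) ≤ K + 1 by positivity)
    push_cast [Nat.cast_sub hyB]
    linarith

/-- Memory sharing between the half-cache and the full-cache scheme. -/
theorem isOptimalUncodedLoad_second_segment (hK : 2 ≤ K)
    (hlt : (b : ℝ) * (K - 1) < 2 * a) {M : ℝ} (hM1 : (a : ℝ) + b < M) (hM2 : M ≤ 2 * a + b) :
    IsOptimalUncodedLoad K a b M
      (((K : ℝ) - 1) * (2 * a + b) / (2 * a) - ((K : ℝ) - 1) / (2 * a) * M) := by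
  have hK' : (2 : ℝ) ≤ K := by exact_mod_cast hK
  have hb0 : (0 : ℝ) ≤ b := Nat.cast_nonneg b
  have ha : (0 : ℝ) < a := by nlinarith
  have hlarge : ∀ᶠ B : ℕ in Filter.atTop, 2 * (a : ℝ) ≤ (M - (a + b)) * B :=
    (tendsto_natCast_atTop_atTop.const_mul_atTop (sub_pos.2 hM1)).eventually_ge_atTop _
  refine isOptimalUncodedLoad_of (fun B R hB h => le_load_second_segment hK hlt hB h)
      (c := K - 1) ?_
  filter_upwards [hlarge] with B hB R hR
  set q : ℝ := (2 * a + b - M) * B / (2 * a) with hq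
  have hq0 : 0 ≤ q := by
    have : 0 ≤ 2 * a + b - M := by linarith
    positivity
  have hqM : q * (2 * a) = (2 * a + b - M) * B := div_mul_cancel₀ _ (by positivity)
  have hqB : (q + 1) * 2 ≤ B := by
    have h2 : (a : ℝ) * ((q + 1) * 2) ≤ a * B := by linarith
    exact le_of_mul_le_mul_left h2 ha
  have hy := Nat.le_ceil q
  have hy' := (Nat.ceil_lt_add_one hq0).le
  have hyB : ⌈q⌉₊ * 2 ≤ B := by
    have : (⌈q⌉₊ : ℝ) * 2 ≤ B := by linarith
    exact_mod_cast this
  refine uncodedAchievable_mixture hK 0 ⌈q⌉₊ (B - ⌈q⌉₊ * 2) (by omega) ?_ ?_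
  · have := mul_le_mul_of_nonneg_right hy (show (0 : ℝ) ≤ 2 * a by positivity)
    push_cast [Nat.cast_sub hyB]
    linarith
  · have h1 : ((K : ℝ) - 1) * (2 * a + b) / (2 * a) * B - (K - 1) / (2 * a) * M * B =
        (K - 1) * q := by
      rw [hq]
      ring
    have h2 := mul_le_mul_of_nonneg_left hy' (show (0 : ℝ) ≤ K - 1 by linarith)
    push_cast
    linarith

/-- Memory sharing between the uncached and the full-cache scheme. -/
theorem isOptimalUncodedLoad_single_segment (hK : 2 ≤ K) (hab : 0 < a + b)
    (hge : 2 * (a : ℝ) ≤ b * (K - 1)) {M : ℝ} (hM0 : 0 ≤ M) (hM : M ≤ 2 * a + b) :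
    IsOptimalUncodedLoad K a b M ((K : ℝ) - K / (2 * a + b) * M) := by
  have hab' : (0 : ℝ) < a + b := by exact_mod_cast hab
  have ha0 : (0 : ℝ) ≤ a := Nat.cast_nonneg a
  refine isOptimalUncodedLoad_of (fun B R hB h => le_load_single_segment hK hab hge hB h) (c := K)
    (Filter.Eventually.of_forall fun B R hR => ?_)
  have hpos : (0 : ℝ) < 2 * a + b := by linarith
  set q : ℝ := M * B / (2 * a + b) with hq
  have hq0 : 0 ≤ q := by positivity
  have hqM : q * (2 * a + b) = M * B := div_mul_cancel₀ _ hpos.ne'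
  have hqB : q ≤ B := by
    have h1 : M * B ≤ (2 * a + b) * B := by gcongr
    have h2 : (2 * a + b : ℝ) * q ≤ (2 * a + b) * B := by linarith
    exact le_of_mul_le_mul_left h2 hpos
  have hy := Nat.floor_le hq0
  have hy' := (Nat.lt_floor_add_one q).le
  have hyB : ⌊q⌋₊ ≤ B := by
    have : (⌊q⌋₊ : ℝ) ≤ B := by linarith
    exact_mod_cast this
  refine uncodedAchievable_mixture hK (B - ⌊q⌋₊) 0 ⌊q⌋₊ (by omega) ?_ ?_
  · have := mul_le_mul_of_nonneg_right hy hpos.le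
    push_cast
    linarith
  · have h1 : (K : ℝ) / (2 * a + b) * M * B = K * q := by
      rw [hq]
      ring
    have h2 := mul_le_mul_of_nonneg_left hy' (show (0 : ℝ) ≤ K by positivity)
    push_cast [Nat.cast_sub hyB]
    linarith

end LocationCaching

theorem theorem1 (K a b : ℕ) (hK : 2 ≤ K) (hab : 0 < a + b) :
    ((b : ℝ) * ((K : ℝ) - 1) < 2 * a →
      (∀ M : ℝ, 0 ≤ M → M ≤ a + b →
        LocationCaching.IsOptimalUncodedLoad K a b M
          ((K : ℝ) - ((K : ℝ) + 1) / (2 * ((a : ℝ) + b)) * M)) ∧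
      (∀ M : ℝ, (a : ℝ) + b < M → M ≤ 2 * a + b →
        LocationCaching.IsOptimalUncodedLoad K a b M
          (((K : ℝ) - 1) * (2 * a + b) / (2 * a) - ((K : ℝ) - 1) / (2 * a) * M))) ∧
    (2 * (a : ℝ) ≤ b * ((K : ℝ) - 1) →
      ∀ M : ℝ, 0 ≤ M → M ≤ 2 * a + b →
        LocationCaching.IsOptimalUncodedLoad K a b M
          ((K : ℝ) - (K : ℝ) / (2 * a + b) * M)) := by
  exact ⟨fun hlt => ⟨fun _ hM0 hM =>
      LocationCaching.isOptimalUncodedLoad_first_segment hK hab hlt hM0 hM,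
    fun _ hM1 hM2 => LocationCaching.isOptimalUncodedLoad_second_segment hK hlt hM1 hM2⟩,
    fun hge _ hM0 hM => LocationCaching.isOptimalUncodedLoad_single_segment hK hab hge hM0 hM⟩
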